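/- Let $d,m,n$ be non-negative integers and work in the complex Hilbert space $L^2(\mathbb R^d)$ with Lebesgue measure. For a finite family $\Phi=(\varphi_1,\dots,\varphi_\ell)$ in $L^2(\mathbb R^d)$ let $$\mathcal S(\Phi)=\overline{\operatorname{span}}^{\,L^2}\{\varphi_i(\cdot-k):\ 1\le i\le \ell,\ k\in\mathbb Z^d\}$$ be the shift-invariant space generated by $\Phi$ (the empty family generates $\{0\}$). The length of a finitely generated shift-invariant space $\mathcal S$ is the least $\ell$ such that $\mathcal S=\mathcal S(\varphi_1,\dots,\varphi_\ell)$ for some $\varphi_1,\dots,\varphi_\ell\in \mathcal S$. Let $\mathcal V_n$ be the set of all finitely generated shift-invariant spaces of length at most $n$, and let $P_V$ denote the orthogonal projection of $L^2(\mathbb R^d)$ onto a closed subspace $V$. **Theorem.** Let $\mathcal F=(f_1,\dots,f_m)$ be functions in $L^2(\mathbb R^d)$. Then: 1. There exists $V\in\mathcal V_n$ such that $$\sum_{i=1}^m\|f_i-P_Vf_i\|^2\le\sum_{i=1}^m\|f_i-P_{V'}f_i\|^2\qquad\text{for all } V'\in\mathcal V_n.$$ 2. Such an optimal space $V$ can be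 chosen with $V\subseteq\mathcal S(\mathcal F)$. -/

import Mathlib

open MeasureTheory

noncomputable section

namespace ShiftInvariant

/-- The complex Hilbert space `L²(ℝᵈ)` (Lebesgue measure). -/
abbrev L2 (d : ℕ) : Type := Lp ℂ 2 (volume : Measure (EuclideanSpace ℝ (Fin d)))

/-- The lattice point `k ∈ ℤᵈ`, viewed in `ℝᵈ`. -/
def latticePoint {d : ℕ} (k : Fin d → ℤ) : EuclideanSpace ℝ (Fin d) :=
  WithLp.toLp 2 fun j => (k j : ℝ)

/-- The integer translate `x ↦ φ (x - k)` of `φ ∈ L²(ℝᵈ)`. -/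
def shift {d : ℕ} (k : Fin d → ℤ) (φ : L2 d) : L2 d :=
  Lp.compMeasurePreserving (fun x => x - latticePoint k)
    (measurePreserving_sub_right volume (latticePoint k)) φ

/-- The shift-invariant space `S(Φ)`: the `L²`-closure of the complex linear span of all the
integer translates of the functions `Φ i`. -/
def generatedSpace {d : ℕ} {ι : Type} (Φ : ι → L2 d) : ClosedSubmodule ℂ (L2 d) :=
  (Submodule.span ℂ (Set.range fun p : ι × (Fin d → ℤ) => shift p.2 (Φ p.1))).closure

/-- Finitely generated shift-invariant spaces (the empty family generates the zero space). -/
def IsFSIS {d : ℕ} (S : ClosedSubmodule ℂ (L2 d)) : Prop :=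
  ∃ (l : ℕ) (φ : Fin l → L2 d), S = generatedSpace φ

/-- The length of a finitely generated shift-invariant space: the least number of generators.
It is only meaningful for spaces satisfying `IsFSIS`. -/
def length {d : ℕ} (S : ClosedSubmodule ℂ (L2 d)) : ℕ :=
  sInf {l : ℕ | ∃ φ : Fin l → L2 d, (∀ i, φ i ∈ S) ∧ S = generatedSpace φ}

/-- The class `𝒱ₙ` of all shift-invariant spaces of length at most `n`. -/
def spacesOfLengthLE (d n : ℕ) : Set (ClosedSubmodule ℂ (L2 d)) :=
  {S | IsFSIS S ∧ length S ≤ n}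

/-- The orthogonal projection of `L²(ℝᵈ)` onto a closed subspace `V`. -/
def proj {d : ℕ} (V : ClosedSubmodule ℂ (L2 d)) : L2 d →L[ℂ] L2 d :=
  V.toSubmodule.starProjection

/-- The least squares error `∑ i, ‖f i - P_V (f i)‖²` of the data `f` with respect to `V`. -/
def approxError {d m : ℕ} (f : Fin m → L2 d) (V : ClosedSubmodule ℂ (L2 d)) : ℝ :=
  ∑ i, ‖f i - proj V (f i)‖ ^ 2

end ShiftInvariant

end

noncomputable section

namespace ShiftInvariant

open scoped ComplexConjugate InnerProductSpace
open UnitAddTorus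

/-! Let `K` be the space of `L²` functions supported in the unit cube. Cutting a function along the
lattice and using the pieces as Fourier coefficients gives an isometry `J` from `L²(ℝᵈ)` into the
`K`-valued `L²` space of the torus, and translation by `k` becomes multiplication by the character
`mFourier k` (`exists_fiberization`). A function belongs to `generatedSpace Φ` exactly when almost
every fibre of its image lies in the span of the fibres of the `Φ i` (`ae_mem_fiberSpan`,
`exists_mem_generatedSpace_of_ae_mem_fiberSpan`). The problem therefore decouples: at almost every
`x`, approximate `m` vectors of `K` within a space of dimension at most `n`.

In one fibre, an Eckart–Young type argument (`exists_compress_le`) shows that it suffices to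
consider approximations `compress U y`, built from `n` combinations of the data with coefficients of
modulus at most `1`. The coefficients range over a compact set, so an optimal `U` exists and can be
chosen measurably in `y` (`exists_measurable_compress`). The resulting combinations of the fibres of
`f` are square integrable and pull back to generators in `generatedSpace f`; integrating the
fibrewise inequality gives optimality. -/

/-! ### Measurable selection of minimisers -/

/-- A continuous cost function on `Y × P` with `P` compact has a measurable minimiser. -/
theorem exists_measurable_argmin {Y P : Type*} [TopologicalSpace Y] [MeasurableSpace Y]
    [OpensMeasurableSpace Y] [MetricSpace P] [CompactSpace P] [Nonempty P] [MeasurableSpace P]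
    [BorelSpace P] {c : Y → P → ℝ} (hc : Continuous fun z : Y × P => c z.1 z.2) :
    ∃ s : Y → P, Measurable s ∧ ∀ y p, c y (s y) ≤ c y p := by
  -- Parametrising `P` by the Cantor set gives a linearly ordered compact parameter space, so the
  -- least minimiser is a canonical choice.
  obtain ⟨g, hg, hgs⟩ := exists_nat_bool_continuous_surjective_of_compact P
  let φ : cantorSet → P := g ∘ cantorSetHomeomorphNatToBool
  have hφ : Continuous φ := hg.comp cantorSetHomeomorphNatToBool.continuous
  have hφs : Function.Surjective φ := hgs.comp cantorSetHomeomorphNatToBool.surjective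
  have : CompactSpace cantorSet := isCompact_iff_compactSpace.mp isCompact_cantorSet
  have hcφ : Continuous fun z : Y × cantorSet => c z.1 (φ z.2) :=
    hc.comp (continuous_fst.prodMk (hφ.comp continuous_snd))
  let A : Y → Set cantorSet := fun y => {t | ∀ t', c y (φ t) ≤ c y (φ t')}
  have hA : IsClosed {z : Y × cantorSet | z.2 ∈ A z.1} := by
    have : {z : Y × cantorSet | z.2 ∈ A z.1} =
        ⋂ t', {z : Y × cantorSet | c z.1 (φ z.2) ≤ c z.1 (φ t')} := by
      ext z
      simp [A]
    rw [this]
    exact isClosed_iInter fun t' =>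
      isClosed_le hcφ (hcφ.comp (continuous_fst.prodMk continuous_const))
  have hne (y : Y) : (A y).Nonempty := by
    have : Nonempty cantorSet := ⟨⟨0, zero_mem_cantorSet⟩⟩
    obtain ⟨t, -, ht⟩ := isCompact_univ.exists_isMinOn (f := fun t => c y (φ t))
      Set.univ_nonempty (hcφ.comp (continuous_const.prodMk continuous_id)).continuousOn
    exact ⟨t, fun t' => ht (Set.mem_univ t')⟩
  have hleast (y : Y) : ∃ t ∈ A y, ∀ t' ∈ A y, t ≤ t' := by
    have hcl : IsClosed (A y) := hA.preimage (continuous_const.prodMk continuous_id)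
    obtain ⟨t, ht⟩ := hcl.isCompact.exists_isLeast (hne y)
    exact ⟨t, ht.1, fun t' ht' => ht.2 ht'⟩
  choose s hs hsl using hleast
  refine ⟨φ ∘ s, hφ.measurable.comp ?_, fun y p => ?_⟩
  · refine Measurable.subtype_mk (f := fun y => (s y : ℝ)) ?_
    refine measurable_of_Iic fun a => IsClosed.measurableSet ?_
    -- Sublevel sets of the least minimiser are projections of closed sets along a compact factor,
    -- hence closed.
    have : (fun y => (s y : ℝ)) ⁻¹' Set.Iic a =
        Prod.fst '' ({z : Y × cantorSet | z.2 ∈ A z.1} ∩ {z | (z.2 : ℝ) ≤ a}) := by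
      ext y
      constructor
      · intro h
        exact ⟨(y, s y), ⟨hs y, h⟩, rfl⟩
      · rintro ⟨⟨y, t⟩, ⟨h1, h2⟩, rfl⟩
        exact le_trans (show (s y : ℝ) ≤ t from hsl y t h1) h2
    rw [this]
    exact isClosedMap_fst_of_compactSpace _ (hA.inter
      (isClosed_le (continuous_subtype_val.comp continuous_snd) continuous_const))
  · obtain ⟨t, rfl⟩ := hφs p
    exact hs y t

/-! ### Low-rank approximation in a single fibre -/

/-- Precomposing with an orthogonal projection does not increase the Hilbert–Schmidt norm. -/
theorem sum_norm_sq_comp_starProjection_le {ι E K : Type*} [Fintype ι] [NormedAddCommGroup E]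
    [InnerProductSpace ℂ E] [FiniteDimensional ℂ E] [NormedAddCommGroup K] [InnerProductSpace ℂ K]
    (e : OrthonormalBasis ι ℂ E) (A : E →ₗ[ℂ] K) (N : Submodule ℂ E) :
    ∑ i, ‖A (N.starProjection (e i))‖ ^ 2 ≤ ∑ i, ‖A (e i)‖ ^ 2 := by
  -- `K` need not be complete; corestricting to the finite-dimensional range makes the adjoint
  -- available.
  let B : E →ₗ[ℂ] A.range := A.rangeRestrict
  let w := stdOrthonormalBasis ℂ A.range
  have key (x : E) : ‖A x‖ ^ 2 = ∑ k, ‖⟪B.adjoint (w k), x⟫_ℂ‖ ^ 2 := by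
    simp_rw [LinearMap.adjoint_inner_left]
    rw [w.sum_sq_norm_inner_right]
    rfl
  simp_rw [key]
  rw [Finset.sum_comm, Finset.sum_comm (γ := ι)]
  refine Finset.sum_le_sum fun k _ => ?_
  simp_rw [← Submodule.inner_starProjection_left_eq_right]
  rw [e.sum_sq_norm_inner_left, e.sum_sq_norm_inner_left]
  gcongr
  exact N.norm_starProjection_apply_le _

/-- The approximation of `y` by the span of the combinations of `y` with coefficients the rows
of `U`. -/
def compress {m n : ℕ} {K : Type*} [AddCommGroup K] [Module ℂ K] (U : Fin n → Fin m → ℂ)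
    (y : Fin m → K) (i : Fin m) : K :=
  ∑ j, conj (U j i) • ∑ l, U j l • y l

/-- View `y` and `p` as maps `F` and `R` on `ℂᵐ`, and let `Z` be the kernel of `R`. Replacing `R` by
`F` composed with the projection onto `Zᗮ` leaves the error `F ∘ P_Z = (F - R) ∘ P_Z`, whose
Hilbert–Schmidt norm is at most that of `F - R`. The rows of `U` are an orthonormal basis of `Zᗮ`,
padded by zeros. -/
theorem exists_compress_le {m n : ℕ} {K : Type*} [NormedAddCommGroup K] [InnerProductSpace ℂ K]
    (y p : Fin m → K) (h : Module.finrank ℂ (Submodule.span ℂ (Set.range p)) ≤ n) :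
    ∃ U : Fin n → Fin m → ℂ, (∀ j l, ‖U j l‖ ≤ 1) ∧
      ∑ i, ‖y i - compress U y i‖ ^ 2 ≤ ∑ i, ‖y i - p i‖ ^ 2 := by
  let e := EuclideanSpace.basisFun (Fin m) ℂ
  let F : EuclideanSpace ℂ (Fin m) →ₗ[ℂ] K := e.toBasis.constr ℂ y
  let R : EuclideanSpace ℂ (Fin m) →ₗ[ℂ] K := e.toBasis.constr ℂ p
  have hF (i) : F (e i) = y i := by
    rw [← e.coe_toBasis]
    exact e.toBasis.constr_basis ℂ y i
  have hR (i) : R (e i) = p i := by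
    rw [← e.coe_toBasis]
    exact e.toBasis.constr_basis ℂ p i
  have hF' (x) : F x = ∑ l, x l • y l := by
    simp [F, Module.Basis.constr_apply_fintype, e]
  set Z := LinearMap.ker R with hZ
  have hrank : Module.finrank ℂ Zᗮ ≤ n := by
    have h1 := Z.finrank_add_finrank_orthogonal
    have h2 := R.finrank_range_add_finrank_ker
    have h3 : LinearMap.range R = Submodule.span ℂ (Set.range p) :=
      e.toBasis.constr_range ℂ
    rw [h3, ← hZ] at h2
    omega
  let u := stdOrthonormalBasis ℂ Zᗮ
  let v : Fin n → EuclideanSpace ℂ (Fin m) := fun j =>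
    if hj : (j : ℕ) < Module.finrank ℂ Zᗮ then (u ⟨j, hj⟩ : EuclideanSpace ℂ (Fin m)) else 0
  have hproj (x : EuclideanSpace ℂ (Fin m)) :
      Zᗮ.starProjection x = ∑ j, ⟪v j, x⟫_ℂ • v j := by
    have h1 : Zᗮ.starProjection x = ∑ j, ⟪(u j : EuclideanSpace ℂ (Fin m)), x⟫_ℂ •
        (u j : EuclideanSpace ℂ (Fin m)) := by
      rw [u.starProjection_eq_sum_rankOne]
      simp
    rw [h1]
    refine Finset.sum_of_injOn (Fin.castLE hrank) (Fin.castLE_injective hrank).injOn (by simp)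
      (fun j _ hj => ?_) (fun j _ => by simp [v])
    have : ¬ (j : ℕ) < Module.finrank ℂ Zᗮ := fun hlt => hj ⟨⟨j, hlt⟩, by simp, rfl⟩
    simp [v, this]
  refine ⟨fun j l => v j l, fun j l => ?_, ?_⟩
  · refine (PiLp.norm_apply_le (v j) l).trans ?_
    by_cases hj : (j : ℕ) < Module.finrank ℂ Zᗮ
    · simp only [v, hj, dif_pos]
      exact (u.orthonormal.1 ⟨j, hj⟩).le
    · simp [v, hj]
  · have h1 (i) : compress (fun j l => v j l) y i = F (Zᗮ.starProjection (e i)) := by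
      rw [hproj, map_sum]
      refine Finset.sum_congr rfl fun j _ => ?_
      rw [map_smul, hF']
      congr 1
      simp [e, EuclideanSpace.inner_single_right]
    have h2 (i) : y i - compress (fun j l => v j l) y i = (F - R) (Z.starProjection (e i)) := by
      have h3 : Zᗮ.starProjection (e i) = e i - Z.starProjection (e i) :=
        Z.starProjection_orthogonal_val (e i)
      have h4 : R (Z.starProjection (e i)) = 0 := Z.starProjection_apply_mem (e i)
      rw [h1, h3, map_sub, hF, LinearMap.sub_apply, h4]
      abel
    have h5 (i) : y i - p i = (F - R) (e i) := by rw [LinearMap.sub_apply, hF, hR]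
    simp_rw [h2, h5]
    exact sum_norm_sq_comp_starProjection_le e (F - R) Z

/-! ### Fourier uniqueness on the torus -/

/-- The normalised Haar measure on the torus. -/
abbrev torusMeasure (d : ℕ) : Measure (UnitAddTorus (Fin d)) :=
  Measure.pi fun _ => AddCircle.haarAddCircle

/-- Indicators of closed sets are bounded pointwise limits of continuous functions, so dominated
convergence makes all integrals of `h` over closed sets vanish. -/
theorem ae_eq_zero_of_forall_integral_continuousMap_mul_eq_zero {X : Type*} [TopologicalSpace X]
    [CompactSpace X] [HasOuterApproxClosed X] [MeasurableSpace X] [BorelSpace X] {μ : Measure X}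
    [IsFiniteMeasure μ] {h : X → ℂ} (hh : Integrable h μ)
    (h0 : ∀ φ : C(X, ℂ), ∫ x, φ x * h x ∂μ = 0) : h =ᵐ[μ] 0 := by
  refine ae_eq_zero_of_forall_setIntegral_isClosed_eq_zero hh fun F hF => ?_
  rw [← integral_indicator hF.measurableSet]
  refine tendsto_nhds_unique (f := fun n : ℕ => ∫ x, ((hF.apprSeq n x : ℝ) : ℂ) * h x ∂μ)
    (l := Filter.atTop) ?_ ?_
  · refine tendsto_integral_of_dominated_convergence (fun x => ‖h x‖) (fun n => ?_) hh.norm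
      (fun n => ?_) (ae_of_all _ fun x => ?_)
    · refine AEStronglyMeasurable.mul ?_ hh.aestronglyMeasurable
      have : Continuous fun x => ((hF.apprSeq n x : ℝ) : ℂ) :=
        Complex.continuous_ofReal.comp (NNReal.continuous_coe.comp (hF.apprSeq n).continuous)
      exact this.measurable.aestronglyMeasurable
    · refine ae_of_all _ fun x => ?_
      rw [norm_mul, Complex.norm_real, NNReal.norm_eq]
      exact mul_le_of_le_one_left (norm_nonneg _)
        (mod_cast HasOuterApproxClosed.apprSeq_apply_le_one hF n x)
    · have h1 := tendsto_pi_nhds.mp (HasOuterApproxClosed.tendsto_apprSeq hF) x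
      have h2 := (((Complex.continuous_ofReal.comp NNReal.continuous_coe).tendsto _).comp
        h1).mul_const (h x)
      have h3 : F.indicator h x =
          (Complex.ofReal ∘ NNReal.toReal) (F.indicator (fun _ => 1) x) * h x := by
        by_cases hx : x ∈ F <;> simp [hx]
      rw [h3]
      exact h2
  · have (n : ℕ) : ∫ x, ((hF.apprSeq n x : ℝ) : ℂ) * h x ∂μ = 0 :=
      h0 ⟨fun x => ((hF.apprSeq n x : ℝ) : ℂ),
        Complex.continuous_ofReal.comp (NNReal.continuous_coe.comp (hF.apprSeq n).continuous)⟩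
    simp [this]

/-- An integrable function on the torus with vanishing Fourier coefficients vanishes. -/
theorem ae_eq_zero_of_forall_integral_mFourier_mul_eq_zero {d : ℕ} {h : UnitAddTorus (Fin d) → ℂ}
    (hh : Integrable h (torusMeasure d))
    (h0 : ∀ k, ∫ x, mFourier k x * h x ∂(torusMeasure d) = 0) : h =ᵐ[torusMeasure d] 0 := by
  have hint (φ : C(UnitAddTorus (Fin d), ℂ)) :
      Integrable (fun x => φ x * h x) (torusMeasure d) :=
    hh.bdd_mul (c := ‖φ‖) φ.continuous.aestronglyMeasurable
      (ae_of_all _ fun x => φ.norm_coe_le_norm x)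
  refine ae_eq_zero_of_forall_integral_continuousMap_mul_eq_zero hh fun φ => ?_
  let L : C(UnitAddTorus (Fin d), ℂ) →ₗ[ℂ] ℂ :=
    { toFun := fun φ => ∫ x, φ x * h x ∂(torusMeasure d)
      map_add' := fun φ ψ => by
        rw [← integral_add (hint φ) (hint ψ)]
        simp [add_mul]
      map_smul' := fun a φ => by
        simp [mul_assoc, integral_const_mul] }
  have hL : Continuous L := by
    refine AddMonoidHomClass.continuous_of_bound L (∫ x, ‖h x‖ ∂(torusMeasure d)) fun φ => ?_
    rw [mul_comm, ← integral_const_mul]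
    refine norm_integral_le_of_norm_le (hh.norm.const_mul _) (ae_of_all _ fun x => ?_)
    rw [norm_mul]
    gcongr
    exact φ.norm_coe_le_norm x
  have hle : (Submodule.span ℂ (Set.range (mFourier (d := Fin d)))).topologicalClosure ≤
      LinearMap.ker L := by
    refine Submodule.topologicalClosure_minimal _ (Submodule.span_le.mpr ?_)
      (isClosed_singleton.preimage hL)
    rintro _ ⟨k, rfl⟩
    exact h0 k
  rw [span_mFourier_closure_eq_top] at hle
  exact hle (Submodule.mem_top (x := φ))

theorem integral_mFourier {d : ℕ} (k : Fin d → ℤ) :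
    ∫ x, mFourier k x ∂(torusMeasure d) = if k = 0 then 1 else 0 := by
  have h := (orthonormal_iff_ite.mp (orthonormal_mFourier (d := Fin d))) 0 k
  simp only [ContinuousMap.inner_toLp, ← mFourier_neg, ← mFourier_add] at h
  simpa [eq_comm] using! h.symm

/-! ### Integer translates and the unit cube -/

section Shift

variable {d : ℕ}

/-- Translation by `k` as a linear isometry. -/
def shiftₗᵢ (k : Fin d → ℤ) : L2 d →ₗᵢ[ℂ] L2 d :=
  Lp.compMeasurePreservingₗᵢ ℂ (fun x => x - latticePoint k)
    (measurePreserving_sub_right volume (latticePoint k))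

@[simp]
theorem shiftₗᵢ_apply (k : Fin d → ℤ) (φ : L2 d) : shiftₗᵢ k φ = shift k φ := rfl

theorem coeFn_shift (k : Fin d → ℤ) (φ : L2 d) :
    shift k φ =ᵐ[volume] fun x => φ (x - latticePoint k) :=
  Lp.coeFn_compMeasurePreserving _ _

theorem latticePoint_add (k l : Fin d → ℤ) :
    latticePoint (k + l) = latticePoint k + latticePoint l := by
  ext j
  simp [latticePoint]

theorem latticePoint_zero : latticePoint (0 : Fin d → ℤ) = 0 := by
  ext j
  simp [latticePoint]

theorem shift_shift (k l : Fin d → ℤ) (φ : L2 d) : shift k (shift l φ) = shift (k + l) φ := by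
  refine Lp.ext ?_
  have h := (measurePreserving_sub_right volume
    (latticePoint k)).quasiMeasurePreserving.tendsto_ae.eventually (coeFn_shift l φ)
  filter_upwards [coeFn_shift k (shift l φ), coeFn_shift (k + l) φ, h] with x h1 h2 h3
  rw [h1, h2, h3, latticePoint_add]
  congr 1
  abel

theorem shift_zero (φ : L2 d) : shift 0 φ = φ := by
  refine Lp.ext ?_
  filter_upwards [coeFn_shift 0 φ] with x h1
  rw [h1, latticePoint_zero, sub_zero]

theorem inner_shift_left (k : Fin d → ℤ) (φ ψ : L2 d) :
    ⟪shift k φ, ψ⟫_ℂ = ⟪φ, shift (-k) ψ⟫_ℂ := by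
  rw [← (shiftₗᵢ k).inner_map_map φ, shiftₗᵢ_apply, shiftₗᵢ_apply, shift_shift, add_neg_cancel,
    shift_zero]

/-- The half-open unit cube. -/
def unitCube (d : ℕ) : Set (EuclideanSpace ℝ (Fin d)) := {x | ∀ j, ⌊x j⌋ = 0}

theorem measurableSet_unitCube : MeasurableSet (unitCube d) := by
  unfold unitCube
  rw [show {x : EuclideanSpace ℝ (Fin d) | ∀ j, ⌊x j⌋ = 0} =
    ⋂ j, (fun x : EuclideanSpace ℝ (Fin d) => ⌊x j⌋) ⁻¹' {0} by ext; simp]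
  refine MeasurableSet.iInter fun j => ?_
  have : Measurable fun x : EuclideanSpace ℝ (Fin d) => ⌊x j⌋ :=
    Int.measurable_floor.comp (by fun_prop)
  exact this (measurableSet_singleton 0)

theorem sub_latticePoint_mem_unitCube (x : EuclideanSpace ℝ (Fin d)) (k : Fin d → ℤ) :
    x - latticePoint k ∈ unitCube d ↔ k = fun j => ⌊x j⌋ := by
  simp only [unitCube, latticePoint, Set.mem_ofPred_eq, PiLp.sub_apply, Int.floor_sub_intCast,
    sub_eq_zero, funext_iff]
  exact forall_congr' fun j => eq_comm

variable (d) in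
/-- The functions vanishing outside the unit cube. -/
def cubeSpace : Submodule ℂ (L2 d) :=
  LinearMap.ker (LpToLpRestrictCLM (EuclideanSpace ℝ (Fin d)) ℂ ℂ volume 2
    (unitCube d)ᶜ).toLinearMap

instance : CompleteSpace (cubeSpace d) :=
  (ContinuousLinearMap.isClosed_ker (LpToLpRestrictCLM (EuclideanSpace ℝ (Fin d)) ℂ ℂ volume 2
    (unitCube d)ᶜ)).completeSpace_coe

theorem mem_cubeSpace {ψ : L2 d} :
    ψ ∈ cubeSpace d ↔ ∀ᵐ x ∂volume, x ∉ unitCube d → ψ x = 0 := by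
  have h := LpToLpRestrictCLM_coeFn (F := ℂ) (p := 2) ℂ (unitCube d)ᶜ ψ
  simp_rw [← Set.mem_compl_iff]
  rw [cubeSpace, LinearMap.mem_ker, ← ae_restrict_iff' measurableSet_unitCube.compl]
  constructor
  · intro h0
    rw [ContinuousLinearMap.coe_coe] at h0
    rw [h0] at h
    filter_upwards [h, Lp.coeFn_zero ℂ 2 (volume.restrict (unitCube d)ᶜ)] with x h1 h2
    rw [← h1, h2]
    rfl
  · intro h0
    refine Lp.ext ?_
    filter_upwards [h, h0, Lp.coeFn_zero ℂ 2 (volume.restrict (unitCube d)ᶜ)] with x h1 h2 h3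
    rw [ContinuousLinearMap.coe_coe, h1, h2, h3]
    rfl

theorem inner_shift_shift_eq_zero {φ ψ : L2 d} (hφ : φ ∈ cubeSpace d) (hψ : ψ ∈ cubeSpace d)
    {k l : Fin d → ℤ} (hkl : k ≠ l) : ⟪shift k φ, shift l ψ⟫_ℂ = 0 := by
  rw [L2.inner_def]
  refine integral_eq_zero_of_ae ?_
  have h (k : Fin d → ℤ) {φ : L2 d} (hφ : φ ∈ cubeSpace d) :
      ∀ᵐ x ∂volume, x - latticePoint k ∉ unitCube d → φ (x - latticePoint k) = 0 :=
    (measurePreserving_sub_right volume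
      (latticePoint k)).quasiMeasurePreserving.tendsto_ae.eventually (mem_cubeSpace.mp hφ)
  filter_upwards [coeFn_shift k φ, coeFn_shift l ψ, h k hφ, h l hψ] with x h1 h2 h3 h4
  rw [h1, h2]
  by_cases hk : x - latticePoint k ∈ unitCube d
  · have hl : x - latticePoint l ∉ unitCube d := by
      rw [sub_latticePoint_mem_unitCube] at hk ⊢
      exact fun hl => hkl (hk.trans hl.symm)
    simp [h4 hl]
  · simp [h3 hk]

theorem eq_zero_on_unitCube_of_orthogonal {g : L2 d} (hg : g ∈ (cubeSpace d)ᗮ) :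
    ∀ᵐ x ∂volume, x ∈ unitCube d → g x = 0 := by
  -- The restriction `q` of `g` to the cube lies in `cubeSpace d` and satisfies `⟪q, q⟫ = ⟪q, g⟫ =
  -- 0`.
  let q : L2 d := ((Lp.memLp g).indicator measurableSet_unitCube).toLp
  have hq : q =ᵐ[volume] (unitCube d).indicator g := MemLp.coeFn_toLp _
  have hqm : q ∈ cubeSpace d := by
    rw [mem_cubeSpace]
    filter_upwards [hq] with x hx hxc
    rw [hx, Set.indicator_of_notMem hxc]
  have h0 : ⟪q, q⟫_ℂ = 0 := by
    have h1 : ⟪q, q⟫_ℂ = ⟪q, g⟫_ℂ := by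
      rw [L2.inner_def, L2.inner_def]
      refine integral_congr_ae ?_
      filter_upwards [hq] with x hx
      rw [hx]
      by_cases hxc : x ∈ unitCube d <;> simp [hxc]
    rw [h1]
    exact hg q hqm
  have hq0 : q = 0 := inner_self_eq_zero.mp h0
  rw [hq0] at hq
  filter_upwards [hq, Lp.coeFn_zero ℂ 2 (volume : Measure (EuclideanSpace ℝ (Fin d)))]
    with x h1 h2 hx
  rw [h2, Set.indicator_of_mem hx] at h1
  exact h1.symm

theorem eq_zero_of_forall_shift_mem_orthogonal {g : L2 d}
    (hg : ∀ k, shift k g ∈ (cubeSpace d)ᗮ) : g = 0 := by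
  have h (k : Fin d → ℤ) :
      ∀ᵐ x ∂volume, x - latticePoint k ∈ unitCube d → g x = 0 := by
    have h1 : ∀ᵐ x ∂volume, x ∈ unitCube d → g (x + latticePoint k) = 0 := by
      filter_upwards [eq_zero_on_unitCube_of_orthogonal (hg (-k)), coeFn_shift (-k) g]
        with x h1 h2 hx
      have h3 : latticePoint (-k) = -latticePoint k := by
        ext j
        simp [latticePoint]
      rw [h2, h3, sub_neg_eq_add] at h1
      exact h1 hx
    have h2 := (measurePreserving_sub_right volume
      (latticePoint k)).quasiMeasurePreserving.tendsto_ae.eventually h1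
    filter_upwards [h2] with x hx hxc
    have := hx hxc
    rwa [sub_add_cancel] at this
  refine Lp.ext ?_
  filter_upwards [ae_all_iff.mpr h,
    Lp.coeFn_zero ℂ 2 (volume : Measure (EuclideanSpace ℝ (Fin d)))] with x hx h0
  rw [h0]
  exact hx _ ((sub_latticePoint_mem_unitCube x _).mpr rfl)

/-- The translates of an orthonormal basis of `cubeSpace d` form an orthonormal basis. -/
def shiftBasis {ι : Type*} (b : HilbertBasis ι ℂ (cubeSpace d)) :
    HilbertBasis ((Fin d → ℤ) × ι) ℂ (L2 d) :=
  HilbertBasis.mkOfOrthogonalEqBot (v := fun p => shift p.1 (b p.2 : L2 d))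
    (by
      classical
      rw [orthonormal_iff_ite]
      rintro ⟨k, i⟩ ⟨l, j⟩
      by_cases hkl : k = l
      · subst hkl
        have h := (orthonormal_iff_ite.mp b.orthonormal) i j
        rw [Submodule.coe_inner] at h
        rw [← shiftₗᵢ_apply, ← shiftₗᵢ_apply, LinearIsometry.inner_map_map, h]
        simp
      · rw [inner_shift_shift_eq_zero (b i).2 (b j).2 hkl]
        simp [hkl])
    (by
      rw [Submodule.eq_bot_iff]
      intro g hg
      refine eq_zero_of_forall_shift_mem_orthogonal fun k => ?_
      have h (i : ι) : ⟪(b i : L2 d), shift k g⟫_ℂ = 0 := by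
        have := inner_shift_left (-k) (b i : L2 d) g
        rw [neg_neg] at this
        rw [← this]
        exact hg _ (Submodule.subset_span ⟨(-k, i), rfl⟩)
      have hle : (Submodule.span ℂ (Set.range b)).topologicalClosure ≤
          LinearMap.ker ((innerSL ℂ (shift k g)).comp (cubeSpace d).subtypeL).toLinearMap := by
        refine Submodule.topologicalClosure_minimal _ (Submodule.span_le.mpr ?_)
          (ContinuousLinearMap.isClosed_ker _)
        rintro _ ⟨i, rfl⟩
        exact inner_eq_zero_symm.mp (h i)
      rw [b.dense_span] at hle
      intro ψ hψ
      exact inner_eq_zero_symm.mp (hle (Submodule.mem_top (x := ⟨ψ, hψ⟩))))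

theorem shiftBasis_apply {ι : Type*} (b : HilbertBasis ι ℂ (cubeSpace d))
    (p : (Fin d → ℤ) × ι) : shiftBasis b p = shift p.1 (b p.2 : L2 d) := by
  simp [shiftBasis]

end Shift

/-! ### Modulations and the fiberization map -/

theorem exists_linearIsometry_of_hilbertBasis {ι H E : Type*} [NormedAddCommGroup H]
    [InnerProductSpace ℂ H] [NormedAddCommGroup E] [InnerProductSpace ℂ E] [CompleteSpace E]
    (b : HilbertBasis ι ℂ H) {v : ι → E} (hv : Orthonormal ℂ v) :
    ∃ J : H →ₗᵢ[ℂ] E, ∀ i, J (b i) = v i := by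
  classical
  refine ⟨hv.orthogonalFamily.linearIsometry.comp b.repr.toLinearIsometry, fun i => ?_⟩
  simp [b.repr_self]

section Modulation

variable {d : ℕ} {K : Type*} [NormedAddCommGroup K] [InnerProductSpace ℂ K]

theorem norm_mFourier_apply (k : Fin d → ℤ) (x : UnitAddTorus (Fin d)) : ‖mFourier k x‖ = 1 := by
  simp only [mFourier, fourier_apply, ContinuousMap.coe_mk, norm_prod, Circle.norm_coe,
    Finset.prod_const_one]

theorem memLp_mFourier_smul (k : Fin d → ℤ) (q : Lp K 2 (torusMeasure d)) :
    MemLp (fun x => mFourier k x • q x) 2 (torusMeasure d) :=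
  (Lp.memLp q).of_le ((mFourier k).continuous.aestronglyMeasurable.smul (Lp.aestronglyMeasurable q))
    (ae_of_all _ fun x => by rw [norm_smul, norm_mFourier_apply, one_mul])

/-- Multiplication by a character of the torus. -/
def modulation (k : Fin d → ℤ) : Lp K 2 (torusMeasure d) →ₗᵢ[ℂ] Lp K 2 (torusMeasure d) where
  toFun q := (memLp_mFourier_smul k q).toLp
  map_add' p q := by
    rw [← MemLp.toLp_add]
    refine MemLp.toLp_congr _ _ ?_
    filter_upwards [Lp.coeFn_add p q] with x hx
    rw [hx]
    simp
  map_smul' a q := by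
    rw [RingHom.id_apply, ← MemLp.toLp_const_smul]
    refine MemLp.toLp_congr _ _ ?_
    filter_upwards [Lp.coeFn_smul a q] with x hx
    rw [hx]
    simp [smul_comm a]
  norm_map' q := by
    have h : ∀ᵐ x ∂(torusMeasure d), ‖(memLp_mFourier_smul k q).toLp _ x‖ = ‖q x‖ := by
      filter_upwards [(memLp_mFourier_smul k q).coeFn_toLp] with x hx
      rw [hx, norm_smul, norm_mFourier_apply, one_mul]
    exact le_antisymm (Lp.norm_le_norm_of_ae_le (h.mono fun x hx => hx.le))
      (Lp.norm_le_norm_of_ae_le (h.mono fun x hx => hx.ge))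

theorem coeFn_modulation (k : Fin d → ℤ) (q : Lp K 2 (torusMeasure d)) :
    modulation k q =ᵐ[torusMeasure d] fun x => mFourier k x • q x :=
  (memLp_mFourier_smul k q).coeFn_toLp

/-- The function `x ↦ e_k(x) v` on the torus. -/
def character (k : Fin d → ℤ) (v : K) : Lp K 2 (torusMeasure d) :=
  modulation k ((memLp_const v).toLp)

theorem coeFn_character (k : Fin d → ℤ) (v : K) :
    character k v =ᵐ[torusMeasure d] fun x => mFourier k x • v := by
  filter_upwards [coeFn_modulation k ((memLp_const v).toLp),
    (memLp_const (μ := torusMeasure d) (p := 2) v).coeFn_toLp] with x h1 h2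
  rw [character, h1, h2]

theorem modulation_character (k l : Fin d → ℤ) (v : K) :
    modulation k (character l v) = character (k + l) v := by
  refine Lp.ext ?_
  filter_upwards [coeFn_modulation k (character l v), coeFn_character l v,
    coeFn_character (k + l) v] with x h1 h2 h3
  rw [h1, h2, h3, mFourier_add, mul_smul]

theorem inner_character (k l : Fin d → ℤ) (v w : K) :
    ⟪character k v, character l w⟫_ℂ = if k = l then ⟪v, w⟫_ℂ else 0 := by
  rw [L2.inner_def]
  have : ∀ᵐ x ∂(torusMeasure d), ⟪(character k v : UnitAddTorus (Fin d) → K) x,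
      character l w x⟫_ℂ = mFourier (-k + l) x * ⟪v, w⟫_ℂ := by
    filter_upwards [coeFn_character k v, coeFn_character l w] with x h1 h2
    rw [h1, h2, inner_smul_left, inner_smul_right, mFourier_add, mFourier_neg, mul_assoc]
  rw [integral_congr_ae this, integral_mul_const, integral_mFourier]
  simp only [neg_add_eq_zero, ite_mul, one_mul, zero_mul]

end Modulation

/-- Fiberization: `L²(ℝᵈ)` embeds isometrically into a vector-valued `L²` space on the torus in
such a way that integer translations become multiplications by characters. -/
theorem exists_fiberization (d : ℕ) :
    ∃ J : L2 d →ₗᵢ[ℂ] Lp (cubeSpace d) 2 (torusMeasure d),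
      ∀ k φ, J (shift k φ) = modulation k (J φ) := by
  obtain ⟨s, b, hb⟩ := exists_hilbertBasis ℂ (cubeSpace d)
  have hv : Orthonormal ℂ fun p : (Fin d → ℤ) × s => character p.1 (b p.2) := by
    classical
    rw [orthonormal_iff_ite]
    rintro ⟨k, i⟩ ⟨l, j⟩
    rw [inner_character, orthonormal_iff_ite.mp b.orthonormal]
    by_cases h1 : k = l <;> by_cases h2 : i = j <;> simp [h1, h2]
  obtain ⟨J, hJ⟩ := exists_linearIsometry_of_hilbertBasis (shiftBasis b) hv
  refine ⟨J, fun k φ => ?_⟩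
  have hle : (Submodule.span ℂ (Set.range (shiftBasis b))).topologicalClosure ≤
      LinearMap.eqLocus ((J.comp (shiftₗᵢ k)).toLinearMap)
        (((modulation k).comp J).toLinearMap) := by
    refine Submodule.topologicalClosure_minimal _ (Submodule.span_le.mpr ?_)
      (isClosed_eq (J.comp (shiftₗᵢ k)).continuous ((modulation k).comp J).continuous)
    rintro _ ⟨⟨l, i⟩, rfl⟩
    have h1 : shift k (shiftBasis b (l, i)) = shiftBasis b (k + l, i) := by
      rw [shiftBasis_apply, shiftBasis_apply, shift_shift]
    change J (shift k (shiftBasis b (l, i))) = modulation k (J (shiftBasis b (l, i)))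
    rw [h1, hJ, hJ, modulation_character]
  rw [(shiftBasis b).dense_span] at hle
  exact hle (Submodule.mem_top (x := φ))

/-! ### Fibrewise description of shift-invariant spaces -/

section Fibers

/-- An `L²`-convergent sequence has a subsequence converging almost everywhere. -/
theorem isClosed_ae_mem {α E : Type*} [MeasurableSpace α] {μ : Measure α} [NormedAddCommGroup E]
    {W : α → Set E} (hW : ∀ x, IsClosed (W x)) :
    IsClosed {q : Lp E 2 μ | ∀ᵐ x ∂μ, q x ∈ W x} := by
  refine IsSeqClosed.isClosed fun u q hu hq => ?_
  obtain ⟨ns, -, hns⟩ := (tendstoInMeasure_of_tendsto_Lp hq).exists_seq_tendsto_ae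
  filter_upwards [hns, ae_all_iff.mpr hu] with x h1 h2
  exact (hW x).mem_of_tendsto h1 (Filter.Eventually.of_forall fun i => h2 (ns i))

/-- Strong measurability yields Borel measurability of the tuple with no separability assumption on
`E`. -/
theorem stronglyMeasurable_of_forall_apply {ι α E : Type*} [Fintype ι] [MeasurableSpace α]
    [NormedAddCommGroup E] {y : α → ι → E} (hy : ∀ i, StronglyMeasurable fun x => y x i) :
    StronglyMeasurable y := by
  classical
  have h : y = fun x => ∑ i, Pi.single i (y x i) := by
    ext x
    simp
  rw [h]
  exact Finset.stronglyMeasurable_fun_sum _ fun i _ =>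
    (continuous_single i).comp_stronglyMeasurable (hy i)

theorem integrable_norm_sq {α E : Type*} [MeasurableSpace α] {μ : Measure α}
    [NormedAddCommGroup E] (q : Lp E 2 μ) : Integrable (fun x => ‖q x‖ ^ 2) μ :=
  (Lp.memLp q).integrable_norm_pow (by norm_num)

theorem norm_sq_eq_integral {α E : Type*} [MeasurableSpace α] {μ : Measure α}
    [NormedAddCommGroup E] [InnerProductSpace ℂ E] (q : Lp E 2 μ) :
    ‖q‖ ^ 2 = ∫ x, ‖q x‖ ^ 2 ∂μ := by
  have h : ((‖q‖ ^ 2 : ℝ) : ℂ) = ((∫ x, ‖q x‖ ^ 2 ∂μ : ℝ) : ℂ) := by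
    rw [← integral_complex_ofReal]
    push_cast
    refine (inner_self_eq_norm_sq_to_K (𝕜 := ℂ) q).symm.trans ?_
    rw [L2.inner_def]
    exact integral_congr_ae (ae_of_all _ fun x => inner_self_eq_norm_sq_to_K (𝕜 := ℂ) (q x))
  exact_mod_cast h

variable {d : ℕ} {K : Type*} [NormedAddCommGroup K] [InnerProductSpace ℂ K]

/-- The span at `x` of the fibers of the functions `Φ i`. -/
def fiberSpan {ι : Type} (J : L2 d → Lp K 2 (torusMeasure d)) (Φ : ι → L2 d)
    (x : UnitAddTorus (Fin d)) : Submodule ℂ K :=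
  Submodule.span ℂ (Set.range fun i => J (Φ i) x)

/-- The given inner products are the Fourier coefficients of the integrable function `x ↦ ⟪p x, q
x⟫`. -/
theorem ae_inner_eq_zero {p q : Lp K 2 (torusMeasure d)}
    (h : ∀ k : Fin d → ℤ, ⟪modulation k p, q⟫_ℂ = 0) :
    ∀ᵐ x ∂(torusMeasure d), ⟪p x, q x⟫_ℂ = 0 := by
  refine ae_eq_zero_of_forall_integral_mFourier_mul_eq_zero (L2.integrable_inner p q) fun k => ?_
  rw [← h (-k), L2.inner_def]
  refine integral_congr_ae ?_
  filter_upwards [coeFn_modulation (-k) p] with x hx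
  rw [hx, inner_smul_left, ← mFourier_neg, neg_neg]

variable {ι : Type} [Finite ι] {J : L2 d →ₗᵢ[ℂ] Lp K 2 (torusMeasure d)}

theorem ae_mem_fiberSpan (hJ : ∀ k φ, J (shift k φ) = modulation k (J φ)) {Φ : ι → L2 d}
    {p : L2 d} (hp : p ∈ generatedSpace Φ) : ∀ᵐ x ∂(torusMeasure d), J p x ∈ fiberSpan J Φ x := by
  have hfin (x) : FiniteDimensional ℂ (fiberSpan J Φ x) :=
    FiniteDimensional.span_of_finite ℂ (Set.finite_range _)
  let N : Submodule ℂ (L2 d) :=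
    { carrier := {p | ∀ᵐ x ∂(torusMeasure d), J p x ∈ fiberSpan J Φ x}
      add_mem' := fun {p q} hp hq => by
        filter_upwards [hp, hq, Lp.coeFn_add (J p) (J q)] with x h1 h2 h3
        rw [map_add, h3]
        exact add_mem h1 h2
      zero_mem' := by
        filter_upwards [Lp.coeFn_zero K 2 (torusMeasure d)] with x h1
        rw [map_zero, h1]
        exact zero_mem _
      smul_mem' := fun a p hp => by
        filter_upwards [hp, Lp.coeFn_smul a (J p)] with x h1 h2
        rw [map_smul, h2]
        exact Submodule.smul_mem _ _ h1 }
  have hN : IsClosed (N : Set (L2 d)) :=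
    (isClosed_ae_mem fun x => (fiberSpan J Φ x).closed_of_finiteDimensional).preimage J.continuous
  have hle : (Submodule.span ℂ (Set.range fun p : ι × (Fin d → ℤ) =>
      shift p.2 (Φ p.1))).topologicalClosure ≤ N := by
    refine Submodule.topologicalClosure_minimal _ (Submodule.span_le.mpr ?_) hN
    rintro _ ⟨⟨i, k⟩, rfl⟩
    change ∀ᵐ x ∂(torusMeasure d), J (shift k (Φ i)) x ∈ fiberSpan J Φ x
    rw [hJ]
    filter_upwards [coeFn_modulation k (J (Φ i))] with x hx
    rw [hx]
    exact Submodule.smul_mem _ _ (Submodule.subset_span ⟨i, rfl⟩)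
  exact hle (Submodule.mem_closure_iff.mp hp)

theorem shift_mem_generatedSpace {ι : Type} (Φ : ι → L2 d) (i : ι) (k : Fin d → ℤ) :
    shift k (Φ i) ∈ generatedSpace Φ :=
  Submodule.mem_closure_iff.mpr
    (Submodule.le_topologicalClosure _ (Submodule.subset_span ⟨(i, k), rfl⟩))

theorem mem_generatedSpace {ι : Type} (Φ : ι → L2 d) (i : ι) : Φ i ∈ generatedSpace Φ := by
  rw [← shift_zero (Φ i)]
  exact shift_mem_generatedSpace Φ i 0

/-- The image of `generatedSpace Φ` under `J` is complete, so it equals its double orthogonal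
complement. Anything orthogonal to it is orthogonal to every modulated generator, hence fibrewise
orthogonal to `fiberSpan J Φ x`. -/
theorem exists_mem_generatedSpace_of_ae_mem_fiberSpan [CompleteSpace K]
    (hJ : ∀ k φ, J (shift k φ) = modulation k (J φ)) {Φ : ι → L2 d}
    {q : Lp K 2 (torusMeasure d)} (hq : ∀ᵐ x ∂(torusMeasure d), q x ∈ fiberSpan J Φ x) :
    ∃ p ∈ generatedSpace Φ, J p = q := by
  let N : Submodule ℂ (Lp K 2 (torusMeasure d)) := (generatedSpace Φ).toSubmodule.map J.toLinearMap
  have : CompleteSpace (generatedSpace Φ).toSubmodule :=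
    (generatedSpace Φ).isClosed.completeSpace_coe
  have hN : CompleteSpace N := by
    have := J.isometry.isUniformInducing.isComplete_iff.mpr
      (completeSpace_coe_iff_isComplete.mp this)
    exact completeSpace_coe_iff_isComplete.mpr this
  suffices q ∈ N from this
  rw [← N.orthogonal_orthogonal]
  intro g hg
  have h (i : ι) : ∀ᵐ x ∂(torusMeasure d), ⟪J (Φ i) x, g x⟫_ℂ = 0 := by
    refine ae_inner_eq_zero fun k => ?_
    rw [← hJ]
    exact hg _ ⟨_, shift_mem_generatedSpace Φ i k, rfl⟩
  rw [L2.inner_def]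
  refine integral_eq_zero_of_ae ?_
  have : Countable ι := Finite.to_countable
  filter_upwards [ae_all_iff.mpr h, hq] with x h1 h2
  have hle : fiberSpan J Φ x ≤ LinearMap.ker (innerSL ℂ (g x)).toLinearMap := by
    refine Submodule.span_le.mpr ?_
    rintro _ ⟨i, rfl⟩
    exact inner_eq_zero_symm.mp (h1 i)
  exact hle h2

theorem generatedSpace_le_generatedSpace [CompleteSpace K]
    (hJ : ∀ k φ, J (shift k φ) = modulation k (J φ)) {Φ : ι → L2 d} {κ : Type} {Ψ : κ → L2 d}
    (hΨ : ∀ j, Ψ j ∈ generatedSpace Φ) : generatedSpace Ψ ≤ generatedSpace Φ := by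
  refine Submodule.closure_le.mpr (Submodule.span_le.mpr ?_)
  rintro _ ⟨⟨j, k⟩, rfl⟩
  obtain ⟨p, hp, hpq⟩ := exists_mem_generatedSpace_of_ae_mem_fiberSpan hJ (Φ := Φ)
    (q := J (shift k (Ψ j))) (by
      rw [hJ]
      filter_upwards [coeFn_modulation k (J (Ψ j)), ae_mem_fiberSpan hJ (hΨ j)] with x h1 h2
      rw [h1]
      exact Submodule.smul_mem _ _ h2)
  obtain rfl : p = shift k (Ψ j) := J.injective hpq
  exact hp

end Fibers

/-! ### Length, projections and assembly of the optimal space -/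

theorem generatedSpace_mem_spacesOfLengthLE {d n : ℕ} (φ : Fin n → L2 d) :
    generatedSpace φ ∈ spacesOfLengthLE d n :=
  ⟨⟨n, φ, rfl⟩, Nat.sInf_le ⟨φ, mem_generatedSpace φ, rfl⟩⟩

theorem exists_generators_of_mem_spacesOfLengthLE {d n : ℕ} {V : ClosedSubmodule ℂ (L2 d)}
    (hV : V ∈ spacesOfLengthLE d n) : ∃ l ≤ n, ∃ φ : Fin l → L2 d, V = generatedSpace φ := by
  obtain ⟨⟨l, φ, hφ⟩, hn⟩ := hV
  -- Nonemptiness is essential: `sInf ∅ = 0` in `ℕ` would make the length bound meaningless.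
  have hne : {l : ℕ | ∃ φ : Fin l → L2 d, (∀ i, φ i ∈ V) ∧ V = generatedSpace φ}.Nonempty :=
    ⟨l, φ, fun i => hφ ▸ mem_generatedSpace φ i, hφ⟩
  obtain ⟨ψ, -, hψ⟩ := Nat.sInf_mem hne
  exact ⟨_, hn, ψ, hψ⟩

theorem norm_sub_proj_le {d : ℕ} {V : ClosedSubmodule ℂ (L2 d)} (f : L2 d) {p : L2 d}
    (hp : p ∈ V) : ‖f - proj V f‖ ≤ ‖f - p‖ := by
  rw [proj, V.toSubmodule.starProjection_minimal f]
  exact ciInf_le ⟨0, by rintro _ ⟨x, rfl⟩; exact norm_nonneg _⟩ (⟨p, hp⟩ : V.toSubmodule)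

/-- A measurable choice, for every tuple `y`, of coefficients for an optimal compression. -/
theorem exists_measurable_compress (m n : ℕ) {K : Type*} [NormedAddCommGroup K]
    [InnerProductSpace ℂ K] [MeasurableSpace (Fin m → K)] [BorelSpace (Fin m → K)] :
    ∃ s : (Fin m → K) → Fin n → Fin m → ℂ, Measurable s ∧ (∀ y j l, ‖s y j l‖ ≤ 1) ∧
      ∀ y (U : Fin n → Fin m → ℂ), (∀ j l, ‖U j l‖ ≤ 1) →
        ∑ i, ‖y i - compress (s y) y i‖ ^ 2 ≤ ∑ i, ‖y i - compress U y i‖ ^ 2 := by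
  let P := Fin n → Fin m → Metric.closedBall (0 : ℂ) 1
  have : Nonempty (Metric.closedBall (0 : ℂ) 1) := ⟨⟨0, by simp⟩⟩
  let coeffs : P → Fin n → Fin m → ℂ := fun U j l => U j l
  have hcoeffs : Continuous coeffs := by fun_prop
  obtain ⟨s, hs, hmin⟩ := exists_measurable_argmin (Y := Fin m → K) (P := P)
    (c := fun y U => ∑ i, ‖y i - compress (coeffs U) y i‖ ^ 2) (by
      unfold compress
      fun_prop)
  refine ⟨fun y => coeffs (s y), hcoeffs.measurable.comp hs, fun y j l => ?_, fun y U hU => ?_⟩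
  · exact mem_closedBall_zero_iff.mp (s y j l).2
  · exact hmin y fun j l => ⟨U j l, mem_closedBall_zero_iff.mpr (hU j l)⟩

end ShiftInvariant

end

open ShiftInvariant

theorem theorem2p1 (d m n : ℕ) (f : Fin m → ShiftInvariant.L2 d) :
    ∃ V ∈ ShiftInvariant.spacesOfLengthLE d n,
      (∀ V' ∈ ShiftInvariant.spacesOfLengthLE d n,
        ShiftInvariant.approxError f V ≤ ShiftInvariant.approxError f V') ∧
      V ≤ ShiftInvariant.generatedSpace f := by
  obtain ⟨J, hJ⟩ := exists_fiberization d
  let μ := torusMeasure d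
  let K := cubeSpace d
  let : MeasurableSpace (Fin m → K) := borel _
  have : BorelSpace (Fin m → K) := ⟨rfl⟩
  obtain ⟨s, hs, hs1, hsmin⟩ := exists_measurable_compress m n (K := K)
  let y : UnitAddTorus (Fin d) → Fin m → K := fun x i => J (f i) x
  have hy : StronglyMeasurable y :=
    stronglyMeasurable_of_forall_apply fun i => Lp.stronglyMeasurable (J (f i))
  have hU (j l) : Measurable fun x => s (y x) j l :=
    (measurable_pi_apply l).comp ((measurable_pi_apply j).comp (hs.comp hy.measurable))
  -- The bound `1` on the coefficients keeps the measurable combinations in `L²`.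
  have hmem (j : Fin n) : MemLp (fun x => ∑ l, s (y x) j l • y x l) 2 μ := by
    refine memLp_finsetSum _ fun l _ => ?_
    refine (Lp.memLp (J (f l))).of_le ((hU j l).aestronglyMeasurable.smul
      (Lp.aestronglyMeasurable (J (f l)))) (ae_of_all _ fun x => ?_)
    rw [norm_smul]
    exact mul_le_of_le_one_left (norm_nonneg _) (hs1 _ j l)
  have hgen (j : Fin n) : ∃ h ∈ generatedSpace f, J h = (hmem j).toLp := by
    refine exists_mem_generatedSpace_of_ae_mem_fiberSpan hJ ?_
    filter_upwards [(hmem j).coeFn_toLp] with x hx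
    rw [hx]
    exact sum_mem fun l _ => Submodule.smul_mem _ _ (Submodule.subset_span ⟨l, rfl⟩)
  choose h hhf hJh using hgen
  have hJh' (j : Fin n) : J (h j) =ᵐ[μ] fun x => ∑ l, s (y x) j l • y x l := by
    rw [hJh]
    exact (hmem j).coeFn_toLp
  have hmem' (i : Fin m) : MemLp (fun x => compress (s (y x)) (y x) i) 2 μ := by
    refine memLp_finsetSum _ fun j _ => ?_
    refine (hmem j).of_le ((Complex.continuous_conj.measurable.comp
      (hU j i)).aestronglyMeasurable.smul (hmem j).aestronglyMeasurable) (ae_of_all _ fun x => ?_)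
    rw [norm_smul, RCLike.norm_conj]
    exact mul_le_of_le_one_left (norm_nonneg _) (hs1 _ j i)
  have happrox (i : Fin m) : ∃ p ∈ generatedSpace h, J p = (hmem' i).toLp := by
    refine exists_mem_generatedSpace_of_ae_mem_fiberSpan hJ ?_
    filter_upwards [(hmem' i).coeFn_toLp, ae_all_iff.mpr hJh'] with x hx hx'
    rw [hx]
    refine sum_mem fun j _ => Submodule.smul_mem _ _ ?_
    rw [← hx' j]
    exact Submodule.subset_span ⟨j, rfl⟩
  choose p hp hJp using happrox
  have hnorm (q : Fin m → L2 d) : ∑ i, ‖f i - q i‖ ^ 2 = ∫ x, ∑ i, ‖y x i - J (q i) x‖ ^ 2 ∂μ ∧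
      Integrable (fun x => ∑ i, ‖y x i - J (q i) x‖ ^ 2) μ := by
    have h1 (i) : (fun x => ‖J (f i - q i) x‖ ^ 2) =ᵐ[μ] fun x => ‖y x i - J (q i) x‖ ^ 2 := by
      rw [J.map_sub]
      filter_upwards [Lp.coeFn_sub (J (f i)) (J (q i))] with x hx
      rw [hx]
      rfl
    have h2 (i) : Integrable (fun x => ‖y x i - J (q i) x‖ ^ 2) μ :=
      (integrable_norm_sq (J (f i - q i))).congr (h1 i)
    refine ⟨?_, integrable_finsetSum _ fun i _ => h2 i⟩
    rw [integral_finsetSum _ fun i _ => h2 i]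
    refine Finset.sum_congr rfl fun i _ => ?_
    rw [← J.norm_map, norm_sq_eq_integral, integral_congr_ae (h1 i)]
  refine ⟨generatedSpace h, generatedSpace_mem_spacesOfLengthLE h, fun V' hV' => ?_,
    generatedSpace_le_generatedSpace hJ hhf⟩
  obtain ⟨l, hl, φ, rfl⟩ := exists_generators_of_mem_spacesOfLengthLE hV'
  let q : Fin m → L2 d := fun i => proj (generatedSpace φ) (f i)
  have hq (i : Fin m) : q i ∈ generatedSpace φ :=
    (generatedSpace φ).toSubmodule.starProjection_apply_mem (f i)
  -- The `p i` need not be the projections of the `f i`; membership in `generatedSpace h` suffices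
  -- for the upper bound.
  calc approxError f (generatedSpace h) ≤ ∑ i, ‖f i - p i‖ ^ 2 :=
        Finset.sum_le_sum fun i _ => pow_le_pow_left₀ (norm_nonneg _) (norm_sub_proj_le _ (hp i)) 2
    _ ≤ ∑ i, ‖f i - q i‖ ^ 2 := by
        rw [(hnorm p).1, (hnorm q).1]
        refine integral_mono_ae (hnorm p).2 (hnorm q).2 ?_
        have hJp' (i) : J (p i) =ᵐ[μ] fun x => compress (s (y x)) (y x) i := by
          rw [hJp]
          exact (hmem' i).coeFn_toLp
        filter_upwards [ae_all_iff.mpr hJp', ae_all_iff.mpr fun i => ae_mem_fiberSpan hJ (hq i)]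
          with x h1 h2
        -- The competitor's fibres lie in the span of `l ≤ n` vectors, so the single-fibre bound
        -- applies.
        have hrank : Module.finrank ℂ (Submodule.span ℂ (Set.range fun i => J (q i) x)) ≤ n := by
          have : FiniteDimensional ℂ (fiberSpan J φ x) :=
            FiniteDimensional.span_of_finite ℂ (Set.finite_range _)
          calc _ ≤ Module.finrank ℂ (fiberSpan J φ x) :=
                Submodule.finrank_mono (Submodule.span_le.mpr (Set.range_subset_iff.mpr h2))
            _ ≤ Fintype.card (Fin l) := finrank_range_le_card _
            _ ≤ n := by simpa using hl
        obtain ⟨U, hU1, hU2⟩ := exists_compress_le (y x) (fun i => J (q i) x) hrank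
        simp_rw [h1]
        exact (hsmin (y x) U hU1).trans hU2
    _ = approxError f (generatedSpace φ) := rfl
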